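/- There is an absolute constant $C>0$ with the following property. Let $n\ge 1$, let $V:\mathbb{R}^n\to\mathbb{R}$ be bounded and continuous with $V(x)>0$ for all $x\in\mathbb{R}^n$, and let $u_0\in H^2(\mathbb{R}^n)$, $u_1\in L^2(\mathbb{R}^n)$ be real-valued with $$K_{0,p}^2:=\int_{\mathbb{R}^n}\frac{|u_1(x)|^2}{V(x)}\,dx<\infty .$$ Then the Cauchy problem $$u_{tt}+\Delta^2u+V(x)u=0\quad (t>0,\ x\in\mathbb{R}^n),\qquad u(0,x)=u_0(x),\quad u_t(0,x)=u_1(x)\quad (x\in\mathbb{R}^n)$$ has a unique weak solution $u\in C([0,\infty);H^2(\mathbb{R}^n))\cap C^1([0,\infty);L^2(\mathbb{R}^n))$, and it satisfies $$\|u(t,\cdot)\|^2\le C\left(\|u_0\|^2+K_{0,p}^2\right)\qquad\text{for all } t\ge 0,$$ where $\|\cdot\|$ is the norm of $L^2(\mathbb{R}^n)$. Here $u$ is a weak solution if $u(0)=u_0$, $u_t(0)=u_1$ and, for every $\varphi\in H^2(\mathbb{R}^n)$ and every $t\ge 0$ (with a one-sided derivative at $t=0$), $$\frac{d}{dt}\int_{\mathbb{R}^n}u_t\,\varphi\,dx+\int_{\mathbb{R}^n}\Delta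 u\,\Delta\varphi\,dx+\int_{\mathbb{R}^n}V\,u\,\varphi\,dx=0 .$$ -/

import Mathlib

open MeasureTheory Set
open scoped ContDiff BoundedContinuousFunction

namespace Plate

/-- The Euclidean space `ℝⁿ`. -/
abbrev Rn (n : ℕ) : Type := EuclideanSpace ℝ (Fin n)

/-- Real-valued `L²(ℝⁿ)` with respect to Lebesgue measure. -/
abbrev L2 (n : ℕ) : Type := Lp ℝ 2 (volume : Measure (Rn n))

/-- `g` is the weak partial derivative `∂ᵢ f`, tested against `C_c^∞(ℝⁿ)`. -/
def HasWeakPartial {n : ℕ} (i : Fin n) (f g : L2 n) : Prop :=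
  ∀ φ : Rn n → ℝ, ContDiff ℝ ∞ φ → HasCompactSupport φ →
    ∫ x, f x * fderiv ℝ φ x (EuclideanSpace.single i 1) = - ∫ x, g x * φ x

theorem integrable_L2_mul {n : ℕ} (f : L2 n) {ψ : Rn n → ℝ} (hψ : Continuous ψ)
    (hc : HasCompactSupport ψ) : Integrable (fun x => f x * ψ x) :=
  (Lp.memLp f).integrable_mul (hψ.memLp_of_hasCompactSupport (p := 2) hc)

theorem integrable_L2_mul_fderiv {n : ℕ} (i : Fin n) (f : L2 n) {φ : Rn n → ℝ}
    (hφ : ContDiff ℝ ∞ φ) (hc : HasCompactSupport φ) :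
    Integrable (fun x => f x * fderiv ℝ φ x (EuclideanSpace.single i 1)) :=
  integrable_L2_mul f ((hφ.continuous_fderiv (by simp)).clm_apply continuous_const)
    (hc.fderiv_apply ℝ _)

theorem HasWeakPartial.zero {n : ℕ} (i : Fin n) : HasWeakPartial i (0 : L2 n) 0 := by
  intro φ _ _
  have h0 : ((0 : L2 n) : Rn n → ℝ) =ᵐ[volume] 0 := Lp.coeFn_zero _ _ _
  rw [integral_eq_zero_of_ae, integral_eq_zero_of_ae, neg_zero]
  · filter_upwards [h0] with x hx
    rw [hx, Pi.zero_apply, zero_mul]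
  · filter_upwards [h0] with x hx
    rw [hx, Pi.zero_apply, zero_mul]

theorem HasWeakPartial.add {n : ℕ} {i : Fin n} {f g f' g' : L2 n} (h : HasWeakPartial i f g)
    (h' : HasWeakPartial i f' g') : HasWeakPartial i (f + f') (g + g') := by
  intro φ hφ hc
  have e1 : ∫ x, (f + f' : L2 n) x * fderiv ℝ φ x (EuclideanSpace.single i 1)
      = ∫ x, (f x * fderiv ℝ φ x (EuclideanSpace.single i 1)
        + f' x * fderiv ℝ φ x (EuclideanSpace.single i 1)) := by
    apply integral_congr_ae
    filter_upwards [Lp.coeFn_add f f'] with x hx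
    rw [hx, Pi.add_apply, add_mul]
  have e2 : ∫ x, (g + g' : L2 n) x * φ x = ∫ x, (g x * φ x + g' x * φ x) := by
    apply integral_congr_ae
    filter_upwards [Lp.coeFn_add g g'] with x hx
    rw [hx, Pi.add_apply, add_mul]
  rw [e1, e2, integral_add (integrable_L2_mul_fderiv i f hφ hc)
    (integrable_L2_mul_fderiv i f' hφ hc), integral_add (integrable_L2_mul g hφ.continuous hc)
    (integrable_L2_mul g' hφ.continuous hc), h φ hφ hc, h' φ hφ hc]
  ring

theorem HasWeakPartial.smul {n : ℕ} {i : Fin n} {f g : L2 n} (c : ℝ)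
    (h : HasWeakPartial i f g) : HasWeakPartial i (c • f) (c • g) := by
  intro φ hφ hc
  have e1 : ∫ x, (c • f : L2 n) x * fderiv ℝ φ x (EuclideanSpace.single i 1)
      = ∫ x, c * (f x * fderiv ℝ φ x (EuclideanSpace.single i 1)) := by
    apply integral_congr_ae
    filter_upwards [Lp.coeFn_smul c f] with x hx
    rw [hx, Pi.smul_apply, smul_eq_mul, mul_assoc]
  have e2 : ∫ x, (c • g : L2 n) x * φ x = ∫ x, c * (g x * φ x) := by
    apply integral_congr_ae
    filter_upwards [Lp.coeFn_smul c g] with x hx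
    rw [hx, Pi.smul_apply, smul_eq_mul, mul_assoc]
  rw [e1, e2, integral_const_mul, integral_const_mul, h φ hφ hc]
  ring

/-- The Sobolev space `H²(ℝⁿ)`, realised as the space of triples `(f, ∇f, D²f)` of an `L²`
function and its weak partial derivatives of order one and two, all in `L²`. The triple is
determined by `f`. The norm inherited from the product (the maximum of the `L²` norms of the
components) is equivalent to the usual norm of `H²`, so the topology is the usual one. -/
def H2 (n : ℕ) : Submodule ℝ (L2 n × (Fin n → L2 n) × (Fin n → Fin n → L2 n)) where
  carrier := {p | (∀ i, HasWeakPartial i p.1 (p.2.1 i)) ∧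
    ∀ i j, HasWeakPartial j (p.2.1 i) (p.2.2 i j)}
  zero_mem' := ⟨fun i => HasWeakPartial.zero i, fun _ j => HasWeakPartial.zero j⟩
  add_mem' := fun ha hb =>
    ⟨fun i => (ha.1 i).add (hb.1 i), fun i j => (ha.2 i j).add (hb.2 i j)⟩
  smul_mem' := fun c _ ha =>
    ⟨fun i => (ha.1 i).smul c, fun i j => (ha.2 i j).smul c⟩

/-- The underlying `L²` function of an element of `H²`. -/
def toL2 {n : ℕ} (f : H2 n) : L2 n := f.1.1

/-- The weak Laplacian `Δ f = ∑ᵢ ∂ᵢ∂ᵢ f ∈ L²` of `f ∈ H²`. -/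
noncomputable def laplacian {n : ℕ} (f : H2 n) : L2 n := ∑ i, f.1.2.2 i i

/-- `u ∈ C([0,∞); H²) ∩ C¹([0,∞); L²)` is a weak solution of `u_tt + Δ² u + V u = 0` with
`u(0) = u₀`, `u_t(0) = u₁`: for every `φ ∈ H²` and `t ≥ 0`,
`d/dt (u_t, φ) + (Δu, Δφ) + ∫ V u φ = 0` (one-sided derivatives at `t = 0`).
Only the values `u t` with `t ≥ 0` matter. -/
structure IsPlateSolution {n : ℕ} (V : Rn n →ᵇ ℝ) (u₀ : H2 n) (u₁ : L2 n)
    (u : ℝ → H2 n) : Prop where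
  continuousOn : ContinuousOn u (Ici 0)
  initial : u 0 = u₀
  velocity : ∃ ut : ℝ → L2 n, ContinuousOn ut (Ici 0) ∧ ut 0 = u₁ ∧
    (∀ t, 0 ≤ t → HasDerivWithinAt (fun s => toL2 (u s)) (ut t) (Ici 0) t) ∧
    ∀ φ : H2 n, ∀ t, 0 ≤ t →
      HasDerivWithinAt (fun s => inner ℝ (ut s) (toL2 φ))
        (-(inner ℝ (laplacian (u t)) (laplacian φ) + ∫ x, V x * toL2 (u t) x * toL2 φ x))
        (Ici 0) t

end Plate

namespace Plate

open Filter Topology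
open scoped InnerProductSpace

section Calculus

variable {E : Type*} [NormedAddCommGroup E] [NormedSpace ℝ E]

theorem le_add_mul_of_hasDerivAt_le {f f' : ℝ → ℝ} {c : ℝ} (h : ∀ t, HasDerivAt f (f' t) t)
    (hc : ∀ t, 0 ≤ t → f' t ≤ c) {t : ℝ} (ht : 0 ≤ t) : f t ≤ f 0 + c * t := by
  have key := (convex_Ici (0 : ℝ)).image_sub_le_mul_sub_of_deriv_le (f := f) (C := c)
    (fun x _ => (h x).continuousAt.continuousWithinAt)
    (fun x _ => (h x).differentiableAt.differentiableWithinAt)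
    (fun x hx => by
      rw [(h x).deriv]
      exact hc x (interior_subset hx)) 0 self_mem_Ici t ht ht
  simp only [sub_zero] at key
  linarith

theorem continuous_comp_max_zero {E : Type*} [TopologicalSpace E] {g : ℝ → E} (hg : ContinuousOn g (Ici 0)) :
    Continuous fun s => g (max s 0) :=
  hg.comp_continuous (by fun_prop) fun s => le_max_right s 0

theorem hasDerivAt_integral_comp_max_zero [CompleteSpace E] {g : ℝ → E}
    (hg : ContinuousOn g (Ici 0)) (t : ℝ) :
    HasDerivAt (fun s => ∫ r in (0 : ℝ)..s, g (max r 0)) (g (max t 0)) t :=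
  intervalIntegral.integral_hasDerivAt_right
    ((continuous_comp_max_zero hg).intervalIntegrable _ _)
    ((continuous_comp_max_zero hg).stronglyMeasurableAtFilter _ _)
    (continuous_comp_max_zero hg).continuousAt

theorem hasDerivWithinAt_Ici_of_eq_integral [CompleteSpace E] {F g : ℝ → E}
    (hg : ContinuousOn g (Ici 0))
    (hF : ∀ t, 0 ≤ t → F t = F 0 + ∫ r in (0 : ℝ)..t, g (max r 0)) {t : ℝ} (ht : 0 ≤ t) :
    HasDerivWithinAt F (g t) (Ici 0) t := by
  have h := ((hasDerivAt_integral_comp_max_zero hg t).const_add (F 0)).hasDerivWithinAt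
    (s := Ici 0)
  rw [max_eq_left ht] at h
  exact h.congr (fun s hs => hF s hs) (hF t ht)

theorem eq_of_hasDerivWithinAt_Ici_zero {F : ℝ → E}
    (h : ∀ t, 0 ≤ t → HasDerivWithinAt F 0 (Ici 0) t) {t : ℝ} (ht : 0 ≤ t) : F t = F 0 := by
  refine constant_of_has_deriv_right_zero (a := 0) (b := t) ?_ ?_ t ⟨ht, le_rfl⟩
  · exact fun s hs => ((h s hs.1).continuousWithinAt).mono fun r hr => hr.1
  · exact fun s hs => (h s hs.1).mono (Ici_subset_Ici.2 hs.1)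

end Calculus

section Semigroup

variable {X : Type*} [NormedAddCommGroup X] [InnerProductSpace ℝ X]

/-- `R` is firmly nonexpansive, i.e. `1 - R⁻¹` is (formally) dissipative. -/
def FirmlyNonexpansive (R : X →L[ℝ] X) : Prop := ∀ z, ‖R z‖ ^ 2 ≤ ⟪z, R z⟫_ℝ

namespace FirmlyNonexpansive

variable {R : X →L[ℝ] X}

theorem inner_nonpos (hR : FirmlyNonexpansive R) (z : X) : ⟪R z - z, R z⟫_ℝ ≤ 0 := by
  have := hR z
  rw [inner_sub_left, real_inner_self_eq_norm_sq]
  linarith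

variable [CompleteSpace X]

theorem exists_inverse (hR : FirmlyNonexpansive R) {ε : ℝ} (h0 : 0 < ε) (h1 : ε ≤ 1) :
    ∃ N : X →L[ℝ] X, (∀ x, (1 - ε) • R (N x) + ε • N x = x) ∧
      ∀ x, N ((1 - ε) • R x + ε • x) = x := by
  let M : X →L[ℝ] X := (1 - ε) • R + ε • ContinuousLinearMap.id ℝ X
  have hM : ∀ x, M x = (1 - ε) • R x + ε • x := fun x => rfl
  let B : X →L[ℝ] X →L[ℝ] ℝ := (innerSL ℝ).comp M
  have hB : IsCoercive B := by
    refine ⟨ε, h0, fun u => ?_⟩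
    have e : B u u = ⟪M u, u⟫_ℝ := rfl
    rw [e, hM, inner_add_left, inner_smul_left, inner_smul_left, real_inner_self_eq_norm_sq]
    have := (sq_nonneg _).trans (hR u)
    rw [real_inner_comm] at this
    simp only [conj_trivial]
    nlinarith [mul_nonneg (sub_nonneg.2 h1) this]
  let e := hB.continuousLinearEquivOfBilin
  have he : ∀ x, e x = M x := fun x =>
    ext_inner_right ℝ fun w => hB.continuousLinearEquivOfBilin_apply x w
  refine ⟨e.symm, fun x => ?_, fun x => ?_⟩
  · exact (he _).symm.trans (e.apply_symm_apply x)
  · exact (congrArg e.symm (he x).symm).trans (e.symm_apply_apply x)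

/-- The inverse of `(1 - ε) R + ε`. -/
noncomputable def inv (hR : FirmlyNonexpansive R) {ε : ℝ} (h0 : 0 < ε) (h1 : ε ≤ 1) :
    X →L[ℝ] X := (hR.exists_inverse h0 h1).choose

/-- The Yosida approximation of `G = 1 - R⁻¹`. -/
noncomputable def yosida (hR : FirmlyNonexpansive R) {ε : ℝ} (h0 : 0 < ε) (h1 : ε ≤ 1) :
    X →L[ℝ] X := (R - ContinuousLinearMap.id ℝ X).comp (hR.inv h0 h1)

variable (hR : FirmlyNonexpansive R) {ε δ : ℝ} (h0 : 0 < ε) (h1 : ε ≤ 1) (h0' : 0 < δ)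
  (h1' : δ ≤ 1)

theorem yosida_apply (x : X) :
    hR.yosida h0 h1 x = R (hR.inv h0 h1 x) - hR.inv h0 h1 x := rfl

theorem eq_sub_yosida (x : X) : x = R (hR.inv h0 h1 x) - ε • hR.yosida h0 h1 x := by
  have := (hR.exists_inverse h0 h1).choose_spec.1 x
  change (1 - ε) • R (hR.inv h0 h1 x) + ε • hR.inv h0 h1 x = x at this
  rw [yosida_apply]
  nth_rw 1 [← this]
  module

theorem inv_comm (x : X) : hR.inv h0 h1 (R x) = R (hR.inv h0 h1 x) := by
  have h := (hR.exists_inverse h0 h1).choose_spec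
  change (∀ x, (1 - ε) • R (hR.inv h0 h1 x) + ε • hR.inv h0 h1 x = x) ∧
    (∀ x, hR.inv h0 h1 ((1 - ε) • R x + ε • x) = x) at h
  have := h.2 (R (hR.inv h0 h1 x))
  rw [← map_smul R ε, ← map_smul R (1 - ε), ← map_add R, h.1] at this
  exact this

theorem inner_yosida_self_nonpos (x : X) : ⟪hR.yosida h0 h1 x, x⟫_ℝ ≤ 0 := by
  nth_rw 2 [hR.eq_sub_yosida h0 h1 x]
  rw [inner_sub_right, inner_smul_right, real_inner_self_eq_norm_sq]
  have := hR.inner_nonpos (hR.inv h0 h1 x)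
  rw [← yosida_apply] at this
  nlinarith [sq_nonneg ‖hR.yosida h0 h1 x‖]

theorem norm_resolvent_le (x : X) : ‖R (hR.inv h0 h1 x)‖ ≤ ‖x‖ := by
  have h := hR.inner_nonpos (hR.inv h0 h1 x)
  rw [← yosida_apply] at h
  have e : ‖x‖ ^ 2 = ‖R (hR.inv h0 h1 x)‖ ^ 2
      - 2 * ε * ⟪hR.yosida h0 h1 x, R (hR.inv h0 h1 x)⟫_ℝ
      + ε ^ 2 * ‖hR.yosida h0 h1 x‖ ^ 2 := by
    nth_rw 1 [hR.eq_sub_yosida h0 h1 x]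
    rw [norm_sub_sq_real, inner_smul_right, norm_smul, real_inner_comm, Real.norm_eq_abs,
      abs_of_pos h0]
    ring
  refine le_of_sq_le_sq ?_ (norm_nonneg _)
  nlinarith [sq_nonneg (ε * ‖hR.yosida h0 h1 x‖)]

theorem norm_yosida_range_le (w : X) : ‖hR.yosida h0 h1 (R w)‖ ≤ ‖R w - w‖ := by
  rw [yosida_apply, inv_comm, ← map_sub R, ← inv_comm hR h0 h1 w,
    ← map_sub (hR.inv h0 h1)]
  exact hR.norm_resolvent_le h0 h1 _

theorem inner_yosida_sub_le (x y : X) {K : ℝ} (hx : ‖hR.yosida h0 h1 x‖ ≤ K)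
    (hy : ‖hR.yosida h0' h1' y‖ ≤ K) :
    ⟪hR.yosida h0 h1 x - hR.yosida h0' h1' y, x - y⟫_ℝ ≤ 2 * K ^ 2 * (ε + δ) := by
  have h := hR.inner_nonpos (hR.inv h0 h1 x - hR.inv h0' h1' y)
  have e : R (hR.inv h0 h1 x - hR.inv h0' h1' y) - (hR.inv h0 h1 x - hR.inv h0' h1' y)
      = hR.yosida h0 h1 x - hR.yosida h0' h1' y := by
    rw [yosida_apply, yosida_apply, map_sub]; abel
  rw [e, map_sub] at h
  have hd : x - y = (R (hR.inv h0 h1 x) - R (hR.inv h0' h1' y))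
      - (ε • hR.yosida h0 h1 x - δ • hR.yosida h0' h1' y) := by
    nth_rw 1 [hR.eq_sub_yosida h0 h1 x, hR.eq_sub_yosida h0' h1' y]
    abel
  rw [hd, inner_sub_right]
  have hK : 0 ≤ K := (norm_nonneg _).trans hx
  have hb := neg_le_of_abs_le (abs_real_inner_le_norm
    (hR.yosida h0 h1 x - hR.yosida h0' h1' y) (ε • hR.yosida h0 h1 x - δ • hR.yosida h0' h1' y))
  have h2 : ‖hR.yosida h0 h1 x - hR.yosida h0' h1' y‖ ≤ 2 * K :=
    (norm_sub_le _ _).trans (by linarith)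
  have h3 : ‖ε • hR.yosida h0 h1 x - δ • hR.yosida h0' h1' y‖ ≤ (ε + δ) * K := by
    refine (norm_sub_le _ _).trans ?_
    rw [norm_smul, norm_smul, Real.norm_eq_abs, Real.norm_eq_abs, abs_of_pos h0, abs_of_pos h0']
    nlinarith
  have h4 := mul_le_mul h2 h3 (norm_nonneg _) (by positivity)
  linarith

/-- The solution of `u' = G_ε u`, `u 0 = x`, for the Yosida approximation `G_ε`. -/
noncomputable def flow (t : ℝ) : X →L[ℝ] X := NormedSpace.exp (t • hR.yosida h0 h1)

theorem flow_zero (x : X) : hR.flow h0 h1 0 x = x := by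
  simp [flow, NormedSpace.exp_zero]

theorem hasDerivAt_flow (x : X) (t : ℝ) :
    HasDerivAt (fun t => hR.flow h0 h1 t x) (hR.yosida h0 h1 (hR.flow h0 h1 t x)) t := by
  have h := hasDerivAt_exp_smul_const' (𝕂 := ℝ) (hR.yosida h0 h1) t
  exact (ContinuousLinearMap.apply ℝ X x).hasFDerivAt.comp_hasDerivAt t h

theorem norm_le_of_hasDerivAt_yosida {u : ℝ → X}
    (hu : ∀ t, HasDerivAt u (hR.yosida h0 h1 (u t)) t) {t : ℝ} (ht : 0 ≤ t) : ‖u t‖ ≤ ‖u 0‖ := by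
  have := le_add_mul_of_hasDerivAt_le (c := 0) (fun t => (hu t).norm_sq) (fun t _ => by
    have := hR.inner_yosida_self_nonpos h0 h1 (u t)
    rw [real_inner_comm] at this
    linarith) ht
  refine le_of_sq_le_sq (by linarith) (norm_nonneg _)

theorem norm_flow_le (x : X) {t : ℝ} (ht : 0 ≤ t) : ‖hR.flow h0 h1 t x‖ ≤ ‖x‖ := by
  have := hR.norm_le_of_hasDerivAt_yosida h0 h1 (hR.hasDerivAt_flow h0 h1 x) ht
  rwa [flow_zero] at this

theorem norm_yosida_flow_range_le (w : X) {t : ℝ} (ht : 0 ≤ t) :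
    ‖hR.yosida h0 h1 (hR.flow h0 h1 t (R w))‖ ≤ ‖R w - w‖ := by
  have := hR.norm_le_of_hasDerivAt_yosida h0 h1 (u := fun t => hR.yosida h0 h1
    (hR.flow h0 h1 t (R w))) (fun t => (hR.yosida h0 h1).hasFDerivAt.comp_hasDerivAt t
      (hR.hasDerivAt_flow h0 h1 (R w) t)) ht
  simp only [flow_zero] at this
  exact this.trans (hR.norm_yosida_range_le h0 h1 w)

theorem norm_flow_sub_sq_le (w : X) {t : ℝ} (ht : 0 ≤ t) :
    ‖hR.flow h0 h1 t (R w) - hR.flow h0' h1' t (R w)‖ ^ 2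
      ≤ 4 * ‖R w - w‖ ^ 2 * (ε + δ) * t := by
  have := le_add_mul_of_hasDerivAt_le (c := 4 * ‖R w - w‖ ^ 2 * (ε + δ)) (fun t =>
    ((hR.hasDerivAt_flow h0 h1 (R w) t).sub (hR.hasDerivAt_flow h0' h1' (R w) t)).norm_sq)
    (fun t ht => by
      have := hR.inner_yosida_sub_le h0 h1 h0' h1' _ _ (hR.norm_yosida_flow_range_le h0 h1 w ht)
        (hR.norm_yosida_flow_range_le h0' h1' w ht)
      rw [real_inner_comm] at this
      simp only [Pi.sub_apply]
      linarith) ht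
  simpa [flow_zero] using this

theorem denseRange (hR : FirmlyNonexpansive R) (hinj : Function.Injective R) : DenseRange R := by
  have h : (R.range)ᗮ = ⊥ := by
    rw [Submodule.eq_bot_iff]
    intro z hz
    have h := hR z
    rw [real_inner_comm, (Submodule.mem_orthogonal _ z).1 hz (R z) ⟨z, rfl⟩] at h
    refine hinj ?_
    rw [map_zero, ← norm_eq_zero]
    exact pow_eq_zero_iff two_ne_zero |>.1 (le_antisymm h (sq_nonneg _))
  exact Submodule.dense_iff_topologicalClosure_eq_top.2
    (Submodule.topologicalClosure_eq_top_iff.2 h)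

/-- The step sizes used for the Yosida approximations. -/
noncomputable def step (n : ℕ) : ℝ := 1 / ((n : ℝ) + 1)

theorem step_pos (n : ℕ) : 0 < step n := by unfold step; positivity

theorem step_le_one (n : ℕ) : step n ≤ 1 := by
  unfold step
  rw [div_le_one (by positivity)]
  linarith [n.cast_nonneg (α := ℝ)]

theorem tendsto_step : Tendsto step atTop (𝓝 0) := tendsto_one_div_add_atTop_nhds_zero_nat

/-- The sequence of approximate solutions with initial value `x`. -/
noncomputable def approx (n : ℕ) (x : X) (t : ℝ) : X :=
  hR.flow (step_pos n) (step_le_one n) t x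

/-- The sequence of resolvents `(1 - ε G)⁻¹`. -/
noncomputable def resolvent (n : ℕ) (x : X) : X :=
  R (hR.inv (step_pos n) (step_le_one n) x)

theorem norm_approx_sub_le (n : ℕ) (x y : X) {t : ℝ} (ht : 0 ≤ t) :
    ‖hR.approx n x t - hR.approx n y t‖ ≤ ‖x - y‖ := by
  unfold approx
  rw [← map_sub]
  exact hR.norm_flow_le _ _ _ ht

theorem uniformCauchySeqOn_approx (hinj : Function.Injective R) (x : X) (T : ℝ) :
    UniformCauchySeqOn (fun n t => hR.approx n x t) atTop (Icc 0 T) := by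
  rw [Metric.uniformCauchySeqOn_iff]
  intro η hη
  obtain ⟨w, hw⟩ := (hR.denseRange hinj).exists_dist_lt x (show 0 < η / 3 by positivity)
  rw [dist_eq_norm] at hw
  have hlim : Tendsto (fun n => 4 * ‖R w - w‖ ^ 2 * (step n + step n) * |T|) atTop (𝓝 0) := by
    have := ((tendsto_step.add tendsto_step).const_mul (4 * ‖R w - w‖ ^ 2)).mul_const |T|
    simpa using this
  obtain ⟨N, hN⟩ := eventually_atTop.1
    (hlim.eventually (gt_mem_nhds (show (0 : ℝ) < (η / 3) ^ 2 by positivity)))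
  have hstep : ∀ n, N ≤ n → step n ≤ step N := fun n hn => by
    unfold step
    have : (N : ℝ) ≤ n := by exact_mod_cast hn
    gcongr
  refine ⟨N, fun m hm n hn t ht => ?_⟩
  have h1 := hR.norm_approx_sub_le m x (R w) ht.1
  have h2 := hR.norm_approx_sub_le n x (R w) ht.1
  have h3 : ‖hR.approx m (R w) t - hR.approx n (R w) t‖ < η / 3 := by
    refine lt_of_pow_lt_pow_left₀ 2 (by positivity) (lt_of_le_of_lt ?_ (hN N le_rfl))
    refine (hR.norm_flow_sub_sq_le _ _ _ _ w ht.1).trans ?_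
    have : t ≤ |T| := ht.2.trans (le_abs_self T)
    have := step_pos N
    have := step_pos m
    have := step_pos n
    have := hstep m hm
    have := hstep n hn
    have := ht.1
    gcongr
  rw [dist_eq_norm]
  calc ‖hR.approx m x t - hR.approx n x t‖
      = ‖(hR.approx m x t - hR.approx m (R w) t) + (hR.approx m (R w) t - hR.approx n (R w) t)
        - (hR.approx n x t - hR.approx n (R w) t)‖ := by congr 1; abel
    _ ≤ ‖hR.approx m x t - hR.approx m (R w) t‖ + ‖hR.approx m (R w) t - hR.approx n (R w) t‖
        + ‖hR.approx n x t - hR.approx n (R w) t‖ :=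
      (norm_sub_le _ _).trans (add_le_add_left (norm_add_le _ _) _)
    _ < η := by linarith

theorem norm_resolvent_sub_le (n : ℕ) (x y : X) :
    ‖hR.resolvent n x - hR.resolvent n y‖ ≤ ‖x - y‖ := by
  unfold resolvent
  rw [← map_sub, ← map_sub]
  exact hR.norm_resolvent_le _ _ _

theorem tendsto_resolvent (hinj : Function.Injective R) (x : X) :
    Tendsto (fun n => hR.resolvent n x) atTop (𝓝 x) := by
  rw [Metric.tendsto_atTop]
  intro η hη
  obtain ⟨w, hw⟩ := (hR.denseRange hinj).exists_dist_lt x (show 0 < η / 3 by positivity)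
  rw [dist_eq_norm] at hw
  have hlim : Tendsto (fun n => step n * ‖R w - w‖) atTop (𝓝 0) := by
    simpa using tendsto_step.mul_const ‖R w - w‖
  obtain ⟨N, hN⟩ := eventually_atTop.1
    (hlim.eventually (gt_mem_nhds (show (0 : ℝ) < η / 3 by positivity)))
  refine ⟨N, fun n hn => ?_⟩
  have h1 := hR.norm_resolvent_sub_le n x (R w)
  have h2 : ‖hR.resolvent n (R w) - R w‖ ≤ step n * ‖R w - w‖ := by
    have e := hR.eq_sub_yosida (step_pos n) (step_le_one n) (R w)
    have e' : hR.resolvent n (R w) - R w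
        = step n • hR.yosida (step_pos n) (step_le_one n) (R w) := by
      rw [sub_eq_iff_eq_add, ← sub_eq_iff_eq_add']
      exact e.symm
    rw [e', norm_smul, Real.norm_eq_abs, abs_of_pos (step_pos n)]
    exact mul_le_mul_of_nonneg_left (hR.norm_yosida_range_le _ _ w) (step_pos n).le
  rw [dist_eq_norm]
  calc ‖hR.resolvent n x - x‖
      = ‖(hR.resolvent n x - hR.resolvent n (R w)) + (hR.resolvent n (R w) - R w)
        - (x - R w)‖ := by congr 1; abel
    _ ≤ ‖hR.resolvent n x - hR.resolvent n (R w)‖ + ‖hR.resolvent n (R w) - R w‖ + ‖x - R w‖ :=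
      (norm_sub_le _ _).trans (add_le_add_left (norm_add_le _ _) _)
    _ < η := by linarith [hN n hn]

theorem tendsto_resolvent_of_tendsto (hinj : Function.Injective R) {u : ℕ → X} {x : X}
    (hu : Tendsto u atTop (𝓝 x)) : Tendsto (fun n => hR.resolvent n (u n)) atTop (𝓝 x) := by
  have h1 : Tendsto (fun n => hR.resolvent n (u n) - hR.resolvent n x) atTop (𝓝 0) :=
    squeeze_zero_norm (fun n => hR.norm_resolvent_sub_le n (u n) x)
      (tendsto_iff_norm_sub_tendsto_zero.1 hu)
  simpa using h1.add (hR.tendsto_resolvent hinj x)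

theorem continuous_approx (n : ℕ) (x : X) : Continuous (hR.approx n x) :=
  continuous_iff_continuousAt.2 fun t => (hR.hasDerivAt_flow _ _ x t).continuousAt

theorem continuous_resolvent (n : ℕ) : Continuous (hR.resolvent n) :=
  R.continuous.comp (hR.inv _ _).continuous

theorem inner_approx_eq {y z : X} (hyz : ∀ x, ⟪R x - x, y⟫_ℝ = ⟪R x, z⟫_ℝ) (n : ℕ) (x : X)
    (t : ℝ) : ⟪hR.approx n x t, y⟫_ℝ
      = ⟪x, y⟫_ℝ + ∫ s in (0 : ℝ)..t, ⟪hR.resolvent n (hR.approx n x s), z⟫_ℝ := by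
  have hd : ∀ s, HasDerivAt (fun s => ⟪hR.approx n x s, y⟫_ℝ)
      ⟪hR.resolvent n (hR.approx n x s), z⟫_ℝ s := fun s => by
    have := (hR.hasDerivAt_flow (step_pos n) (step_le_one n) x s).inner ℝ (hasDerivAt_const s y)
    rw [yosida_apply, hyz, inner_zero_right, zero_add] at this
    exact this
  rw [intervalIntegral.integral_eq_sub_of_hasDerivAt (fun s _ => hd s)]
  · unfold approx
    rw [flow_zero]
    ring
  · exact (((hR.continuous_resolvent n).comp (hR.continuous_approx n x)).inner
      continuous_const).intervalIntegrable _ _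

/-- Generation theorem for the maximal dissipative operator `1 - R⁻¹`, in weak form. -/
theorem exists_weak_solution (hR : FirmlyNonexpansive R) (hinj : Function.Injective R) (x : X) :
    ∃ u : ℝ → X, ContinuousOn u (Ici 0) ∧ u 0 = x ∧
      ∀ y z : X, (∀ x, ⟪R x - x, y⟫_ℝ = ⟪R x, z⟫_ℝ) → ∀ t, 0 ≤ t →
        HasDerivWithinAt (fun s => ⟪u s, y⟫_ℝ) ⟪u t, z⟫_ℝ (Ici 0) t := by
  have hlim : ∀ t : ℝ, ∃ v, 0 ≤ t → Tendsto (fun n => hR.approx n x t) atTop (𝓝 v) := by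
    intro t
    by_cases ht : 0 ≤ t
    · obtain ⟨v, hv⟩ := cauchySeq_tendsto_of_complete
        ((hR.uniformCauchySeqOn_approx hinj x t).cauchySeq ⟨ht, le_rfl⟩)
      exact ⟨v, fun _ => hv⟩
    · exact ⟨0, fun h => absurd h ht⟩
  choose u hu using hlim
  have hcont : ContinuousOn u (Ici 0) := by
    intro t ht
    have hunif := (hR.uniformCauchySeqOn_approx hinj x (t + 1)).tendstoUniformlyOn_of_tendsto
      (f := u) fun s hs => hu s hs.1
    have hc : ContinuousOn u (Icc 0 (t + 1)) := hunif.continuousOn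
      (Frequently.of_forall fun n => (hR.continuous_approx n x).continuousOn)
    refine (hc t ⟨ht, by linarith⟩).mono_of_mem_nhdsWithin ?_
    rw [← Ici_inter_Iic]
    exact inter_mem_nhdsWithin _ (Iic_mem_nhds (by linarith))
  have hzero : u 0 = x := by
    refine tendsto_nhds_unique (hu 0 le_rfl) ?_
    simp only [approx, flow_zero]
    exact tendsto_const_nhds
  refine ⟨u, hcont, hzero, fun y z hyz t ht => ?_⟩
  refine hasDerivWithinAt_Ici_of_eq_integral (F := fun s => ⟪u s, y⟫_ℝ)
    (g := fun s => ⟪u s, z⟫_ℝ) (hcont.inner continuousOn_const) (fun t ht => ?_) ht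
  simp only [hzero]
  have h1 : Tendsto (fun n => ⟪hR.approx n x t, y⟫_ℝ) atTop (𝓝 ⟪u t, y⟫_ℝ) :=
    (hu t ht).inner tendsto_const_nhds
  refine tendsto_nhds_unique h1 ?_
  simp only [hR.inner_approx_eq hyz]
  refine tendsto_const_nhds.add ?_
  refine intervalIntegral.tendsto_integral_filter_of_dominated_convergence
    (fun _ => ‖x‖ * ‖z‖) (Eventually.of_forall fun n => ?_) (Eventually.of_forall fun n => ?_)
    intervalIntegrable_const (Eventually.of_forall fun s hs => ?_)
  · exact (((hR.continuous_resolvent n).comp (hR.continuous_approx n x)).inner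
      continuous_const).aestronglyMeasurable
  · refine Eventually.of_forall fun s hs => ?_
    rw [uIoc_of_le ht] at hs
    refine (norm_inner_le_norm _ _).trans (mul_le_mul_of_nonneg_right ?_ (norm_nonneg _))
    exact (hR.norm_resolvent_le _ _ _).trans (hR.norm_flow_le _ _ _ hs.1.le)
  · rw [uIoc_of_le ht] at hs
    rw [max_eq_left hs.1.le]
    exact (hR.tendsto_resolvent_of_tendsto hinj (hu s hs.1.le)).inner tendsto_const_nhds

/-- A version of `exists_weak_solution` for the shifted operator `μ - R⁻¹`. -/
theorem exists_weak_solution_shift (hR : FirmlyNonexpansive R) (hinj : Function.Injective R) (μ : ℝ) (x : X) :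
    ∃ u : ℝ → X, ContinuousOn u (Ici 0) ∧ u 0 = x ∧
      ∀ y z : X, (∀ x, ⟪μ • R x - x, y⟫_ℝ = ⟪R x, z⟫_ℝ) → ∀ t, 0 ≤ t →
        HasDerivWithinAt (fun s => ⟪u s, y⟫_ℝ) ⟪u t, z⟫_ℝ (Ici 0) t := by
  obtain ⟨u, hu, hx, h⟩ := hR.exists_weak_solution hinj x
  refine ⟨fun t => Real.exp ((μ - 1) * t) • u t, ?_, by simp [hx], fun y z hyz t ht => ?_⟩
  · exact ContinuousOn.smul (by fun_prop) hu
  · have h1 := h y (z - (μ - 1) • y) (fun x => by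
      have := hyz x
      rw [inner_sub_left, inner_smul_left] at this
      rw [inner_sub_left, inner_sub_right, inner_smul_right, ← this]
      simp only [conj_trivial]
      ring) t ht
    have h2 : HasDerivAt (fun t => Real.exp ((μ - 1) * t))
        (Real.exp ((μ - 1) * t) * (μ - 1)) t := by
      simpa using ((hasDerivAt_id t).const_mul (μ - 1)).exp
    have h3 := h2.hasDerivWithinAt (s := Ici 0) |>.mul h1
    simp only [inner_smul_left, conj_trivial]
    refine h3.congr_deriv ?_
    rw [inner_sub_right, inner_smul_right]
    ring

end FirmlyNonexpansive

end Semigroup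

section SecondOrder

variable {W H : Type*} [NormedAddCommGroup W] [InnerProductSpace ℝ W] [CompleteSpace W]
  [NormedAddCommGroup H] [InnerProductSpace ℝ H] [CompleteSpace H]

/-- The resolvent problem for `u'' + A u = B u`, where `⟪A u, φ⟫ = ⟪u, φ⟫_W`. -/
theorem exists_stationary_solution (ι : W →L[ℝ] H) (B : H →L[ℝ] H) {c : ℝ} (hc : ‖B‖ ≤ c) :
    ∃ S : H →L[ℝ] W, ∀ g φ,
      c * ⟪ι (S g), ι φ⟫_ℝ + ⟪S g, φ⟫_ℝ - ⟪B (ι (S g)), ι φ⟫_ℝ = ⟪g, ι φ⟫_ℝ := by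
  let M : W →L[ℝ] W := c • (ι.adjoint ∘L ι) + ContinuousLinearMap.id ℝ W - ι.adjoint ∘L B ∘L ι
  have hM : ∀ u φ, ⟪M u, φ⟫_ℝ = c * ⟪ι u, ι φ⟫_ℝ + ⟪u, φ⟫_ℝ - ⟪B (ι u), ι φ⟫_ℝ := fun u φ => by
    have : M u = c • ι.adjoint (ι u) + u - ι.adjoint (B (ι u)) := rfl
    rw [this, inner_sub_left, inner_add_left, inner_smul_left,
      ContinuousLinearMap.adjoint_inner_left, ContinuousLinearMap.adjoint_inner_left]
    simp
  have hB : IsCoercive ((innerSL ℝ).comp M) := by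
    refine ⟨1, one_pos, fun u => ?_⟩
    have e : ((innerSL ℝ).comp M) u u = ⟪M u, u⟫_ℝ := rfl
    rw [e, hM, real_inner_self_eq_norm_sq, real_inner_self_eq_norm_sq]
    have h1 := real_inner_le_norm (B (ι u)) (ι u)
    have h2 := mul_le_mul_of_nonneg_right (B.le_opNorm (ι u)) (norm_nonneg (ι u))
    nlinarith [mul_le_mul_of_nonneg_right hc (sq_nonneg ‖ι u‖)]
  let e := hB.continuousLinearEquivOfBilin
  have he : ∀ x w, ⟪e x, w⟫_ℝ = ⟪M x, w⟫_ℝ := hB.continuousLinearEquivOfBilin_apply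
  refine ⟨(e.symm : W →L[ℝ] W) ∘L ι.adjoint, fun g φ => ?_⟩
  rw [← hM, ← he]
  simp only [ContinuousLinearMap.comp_apply, ContinuousLinearEquiv.coe_coe,
    ContinuousLinearEquiv.apply_symm_apply, ContinuousLinearMap.adjoint_inner_left]

/-- The resolvent of the first-order system of `u'' + A u = B u`. -/
theorem exists_system_resolvent (ι : W →L[ℝ] H) (hinj : Function.Injective ι)
    (hdense : DenseRange ι) (B : H →L[ℝ] H) :
    ∃ (μ : ℝ) (R : WithLp 2 (W × H) →L[ℝ] WithLp 2 (W × H)), FirmlyNonexpansive R ∧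
      Function.Injective R ∧
      (∀ x, μ • ι (R x).fst - ι x.fst = (R x).snd) ∧
      ∀ x φ, ⟪μ • (R x).snd - x.snd, ι φ⟫_ℝ
        = -⟪(R x).fst, φ⟫_ℝ + ⟪B (ι (R x).fst), ι φ⟫_ℝ := by
  obtain ⟨μ, hμ1, hμB, hμι⟩ : ∃ μ : ℝ, 1 ≤ μ ∧ ‖B‖ ≤ μ ^ 2 ∧ 1 + ‖B‖ * ‖ι‖ ≤ μ := by
    refine ⟨1 + ‖B‖ + ‖B‖ * ‖ι‖, ?_, ?_, ?_⟩ <;>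
      nlinarith [norm_nonneg B, norm_nonneg ι, mul_nonneg (norm_nonneg B) (norm_nonneg ι)]
  obtain ⟨S, hS⟩ := exists_stationary_solution ι B hμB
  let p : WithLp 2 (W × H) →L[ℝ] W :=
    (ContinuousLinearMap.fst ℝ W H) ∘L (WithLp.prodContinuousLinearEquiv 2 ℝ W H)
  let q : WithLp 2 (W × H) →L[ℝ] H :=
    (ContinuousLinearMap.snd ℝ W H) ∘L (WithLp.prodContinuousLinearEquiv 2 ℝ W H)
  let U : WithLp 2 (W × H) →L[ℝ] W := S ∘L (q + μ • (ι ∘L p))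
  let R : WithLp 2 (W × H) →L[ℝ] WithLp 2 (W × H) :=
    ((WithLp.prodContinuousLinearEquiv 2 ℝ W H).symm : W × H →L[ℝ] WithLp 2 (W × H)) ∘L
      (U.prod (ι ∘L (μ • U - p)))
  have hU : ∀ x, U x = S (x.snd + μ • ι x.fst) := fun x => rfl
  have hR1 : ∀ x, (R x).fst = U x := fun x => rfl
  have hR2 : ∀ x, (R x).snd = ι (μ • U x - x.fst) := fun x => rfl
  have hweak : ∀ x φ, ⟪μ • (R x).snd - x.snd, ι φ⟫_ℝ
        = -⟪(R x).fst, φ⟫_ℝ + ⟪B (ι (R x).fst), ι φ⟫_ℝ := by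
    intro x φ
    have h := hS (x.snd + μ • ι x.fst) φ
    rw [← hU] at h
    rw [hR1, hR2, map_sub, map_smul, inner_sub_left, inner_smul_left, inner_sub_left,
      inner_smul_left]
    rw [inner_add_left, inner_smul_left] at h
    simp only [conj_trivial] at h ⊢
    linarith
  refine ⟨μ, R, fun x => ?_, ?_, fun x => ?_, hweak⟩
  · have h := hweak x (μ • U x - x.fst)
    have hn : ‖R x‖ ^ 2 = ‖U x‖ ^ 2 + ‖(R x).snd‖ ^ 2 := by
      rw [WithLp.prod_norm_sq_eq_of_L2, hR1]
    have hi : ⟪x, R x⟫_ℝ = ⟪x.fst, U x⟫_ℝ + ⟪x.snd, (R x).snd⟫_ℝ := by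
      rw [WithLp.prod_inner_apply]; rfl
    rw [hn, hi]
    rw [← hR2, hR1, inner_sub_left, inner_smul_left, inner_sub_right, inner_smul_right,
      real_inner_self_eq_norm_sq, real_inner_self_eq_norm_sq, real_inner_comm] at h
    simp only [conj_trivial] at h
    have h1 := real_inner_le_norm (B (ι (U x))) ((R x).snd)
    have h2 : ‖B (ι (U x))‖ ≤ ‖B‖ * ‖ι‖ * ‖U x‖ := by
      refine (B.le_opNorm _).trans ?_
      rw [mul_assoc]
      exact mul_le_mul_of_nonneg_left (ι.le_opNorm _) (norm_nonneg _)
    have h3 := mul_le_mul_of_nonneg_right h2 (norm_nonneg (R x).snd)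
    have h4 : ‖B‖ * ‖ι‖ * ‖U x‖ * ‖(R x).snd‖
        ≤ ‖B‖ * ‖ι‖ * (‖U x‖ ^ 2 + ‖(R x).snd‖ ^ 2) := by
      rw [mul_assoc (‖B‖ * ‖ι‖)]
      refine mul_le_mul_of_nonneg_left ?_ (by positivity)
      nlinarith [sq_nonneg (‖U x‖ - ‖(R x).snd‖), sq_nonneg ‖U x‖, sq_nonneg ‖(R x).snd‖]
    have h5 := mul_le_mul_of_nonneg_right hμι
      (show 0 ≤ ‖U x‖ ^ 2 + ‖(R x).snd‖ ^ 2 by positivity)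
    have c1 := real_inner_comm x.snd (R x).snd
    have c2 := real_inner_comm x.fst (U x)
    linarith
  · rw [injective_iff_map_eq_zero]
    intro x hx
    have h1 : U x = 0 := by rw [← hR1, hx]; rfl
    have h2 : (R x).snd = 0 := by rw [hx]; rfl
    have h3 : x.fst = 0 := by
      have := h2
      rw [hR2, h1, smul_zero, zero_sub, map_neg, neg_eq_zero] at this
      exact hinj (by rw [this, map_zero])
    have h4 : x.snd = 0 := by
      refine DenseRange.eq_zero_of_inner_left ℝ hdense fun φ => ?_
      have := hweak x φ
      rw [h2, hR1, h1] at this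
      simpa using this
    exact (WithLp.prodContinuousLinearEquiv 2 ℝ W H).injective (Prod.ext h3 h4)
  · rw [hR1, hR2, map_sub, map_smul]

/-- Well-posedness (existence part) of the abstract wave equation `u'' + A u = B u`, where `A` is
given by the inner product of the form domain `W` and `B` is bounded. -/
theorem exists_wave_solution (ι : W →L[ℝ] H) (hinj : Function.Injective ι)
    (hdense : DenseRange ι) (B : H →L[ℝ] H) (u₀ : W) (u₁ : H) :
    ∃ (u : ℝ → W) (v : ℝ → H), ContinuousOn u (Ici 0) ∧ ContinuousOn v (Ici 0) ∧ u 0 = u₀ ∧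
      v 0 = u₁ ∧ (∀ t, 0 ≤ t → HasDerivWithinAt (fun s => ι (u s)) (v t) (Ici 0) t) ∧
      ∀ φ t, 0 ≤ t → HasDerivWithinAt (fun s => ⟪v s, ι φ⟫_ℝ)
        (-⟪u t, φ⟫_ℝ + ⟪B (ι (u t)), ι φ⟫_ℝ) (Ici 0) t := by
  obtain ⟨μ, R, hR, hRinj, hR1, hR2⟩ := exists_system_resolvent ι hinj hdense B
  obtain ⟨x, hx, hx0, hweak⟩ := hR.exists_weak_solution_shift hRinj μ (WithLp.toLp 2 (u₀, u₁))
  have hu : ContinuousOn (fun t => (x t).fst) (Ici 0) :=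
    ((ContinuousLinearMap.fst ℝ W H) ∘L
      (WithLp.prodContinuousLinearEquiv 2 ℝ W H).toContinuousLinearMap).continuous.comp_continuousOn
        hx
  have hv : ContinuousOn (fun t => (x t).snd) (Ici 0) :=
    ((ContinuousLinearMap.snd ℝ W H) ∘L
      (WithLp.prodContinuousLinearEquiv 2 ℝ W H).toContinuousLinearMap).continuous.comp_continuousOn
        hx
  refine ⟨fun t => (x t).fst, fun t => (x t).snd, hu, hv, by simp [hx0], by simp [hx0],
    fun t ht => ?_, fun φ t ht => ?_⟩
  · refine hasDerivWithinAt_Ici_of_eq_integral hv (fun t ht => ?_) ht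
    refine ext_inner_right ℝ fun ψ => ?_
    have hd : ∀ s, 0 ≤ s → HasDerivWithinAt (fun s => ⟪ι (x s).fst, ψ⟫_ℝ)
        ⟪(x s).snd, ψ⟫_ℝ (Ici 0) s := fun s hs => by
      have := hweak (WithLp.toLp 2 (ι.adjoint ψ, 0)) (WithLp.toLp 2 (0, ψ)) (fun z => by
        simp only [WithLp.prod_inner_apply, inner_zero_right, add_zero, zero_add]
        refine (ContinuousLinearMap.adjoint_inner_right ι _ ψ).trans ?_
        refine congrArg (fun y => ⟪y, ψ⟫_ℝ) (Eq.trans ?_ (hR1 z))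
        rw [← map_smul ι, ← map_sub ι]
        rfl) s hs
      simpa [WithLp.prod_inner_apply, ContinuousLinearMap.adjoint_inner_right] using this
    have hd' : ∀ s, 0 ≤ s → HasDerivWithinAt
        (fun s => ⟪∫ r in (0 : ℝ)..s, (x (max r 0)).snd, ψ⟫_ℝ) ⟪(x s).snd, ψ⟫_ℝ (Ici 0) s :=
      fun s hs => by
        have := ((hasDerivAt_integral_comp_max_zero hv s).inner ℝ
          (hasDerivAt_const s ψ)).hasDerivWithinAt (s := Ici 0)
        simpa [max_eq_left hs] using this
    have := eq_of_hasDerivWithinAt_Ici_zero (F := fun s => ⟪ι (x s).fst, ψ⟫_ℝ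
      - ⟪∫ r in (0 : ℝ)..s, (x (max r 0)).snd, ψ⟫_ℝ) (fun s hs => by
        have := (hd s hs).sub (hd' s hs)
        rwa [sub_self] at this) ht
    simp only [intervalIntegral.integral_same, inner_zero_left, sub_zero] at this
    rw [inner_add_left]
    linarith
  · have := hweak (WithLp.toLp 2 (0, ι φ)) (WithLp.toLp 2 (-φ + ι.adjoint (B.adjoint (ι φ)), 0))
      (fun z => by
        simp only [WithLp.prod_inner_apply, inner_zero_right, add_zero, zero_add]
        refine (hR2 z φ).trans ?_
        simp [inner_add_right, ContinuousLinearMap.adjoint_inner_right]) t ht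
    simpa [WithLp.prod_inner_apply, inner_add_right,
      ContinuousLinearMap.adjoint_inner_right] using this

end SecondOrder

section Sobolev

variable {n : ℕ}

/-- Smooth compactly supported functions on `ℝⁿ`. -/
def IsTest (ψ : Rn n → ℝ) : Prop := ContDiff ℝ ∞ ψ ∧ HasCompactSupport ψ

/-- The classical `i`-th partial derivative. -/
noncomputable def partialDeriv (i : Fin n) (ψ : Rn n → ℝ) (x : Rn n) : ℝ :=
  fderiv ℝ ψ x (EuclideanSpace.single i 1)

namespace IsTest

variable {ψ φ : Rn n → ℝ}

theorem partialDeriv (hψ : IsTest ψ) (i : Fin n) : IsTest (partialDeriv i ψ) :=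
  ⟨(hψ.1.fderiv_right (m := ∞) (by simp)).clm_apply contDiff_const, hψ.2.fderiv_apply ℝ _⟩

theorem comp_sub_const (hψ : IsTest ψ) (v : Rn n) : IsTest fun x => ψ (x - v) :=
  ⟨hψ.1.comp (contDiff_id.sub contDiff_const),
    hψ.2.comp_homeomorph (Homeomorph.subRight v)⟩

theorem memLp (hψ : IsTest ψ) : MemLp ψ 2 (volume : Measure (Rn n)) :=
  hψ.1.continuous.memLp_of_hasCompactSupport hψ.2

/-- A test function as an element of `L²`. -/
noncomputable def toL2 (hψ : IsTest ψ) : L2 n := hψ.memLp.toLp ψ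

theorem coeFn_toL2 (hψ : IsTest ψ) : hψ.toL2 =ᵐ[volume] ψ := hψ.memLp.coeFn_toLp

theorem inner_toL2 (hψ : IsTest ψ) (f : L2 n) : ⟪f, hψ.toL2⟫_ℝ = ∫ x, f x * ψ x := by
  rw [L2.inner_def]
  refine integral_congr_ae ?_
  filter_upwards [hψ.coeFn_toL2] with x hx
  rw [hx]
  simp [mul_comm]

end IsTest

theorem partialDeriv_comp_sub_const (i : Fin n) (ψ : Rn n → ℝ) (v x : Rn n) :
    partialDeriv i (fun x => ψ (x - v)) x = partialDeriv i ψ (x - v) := by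
  simp only [partialDeriv, sub_eq_add_neg, fderiv_comp_add_right]

theorem partialDeriv_comm {ψ : Rn n → ℝ} (hψ : IsTest ψ) (i j : Fin n) :
    partialDeriv i (partialDeriv j ψ) = partialDeriv j (partialDeriv i ψ) := by
  have key : ∀ (v w : Rn n) x, fderiv ℝ (fun y => fderiv ℝ ψ y v) x w
      = fderiv ℝ (fderiv ℝ ψ) x w v := fun v w x => by
    have hd : DifferentiableAt ℝ (fderiv ℝ ψ) x :=
      (hψ.1.fderiv_right (m := 1) (by norm_cast)).differentiable (by simp) x
    rw [fderiv_clm_apply hd (differentiableAt_const v)]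
    simp
  ext x
  change fderiv ℝ (fun y => fderiv ℝ ψ y _) x _ = fderiv ℝ (fun y => fderiv ℝ ψ y _) x _
  rw [key, key]
  exact (hψ.1.contDiffAt.isSymmSndFDerivAt (by
    rw [minSmoothness_of_isRCLikeNormedField]
    norm_cast)) _ _

theorem ext_of_inner_test {f g : L2 n}
    (h : ∀ (ψ : Rn n → ℝ) (hψ : IsTest ψ), ⟪f, hψ.toL2⟫_ℝ = ⟪g, hψ.toL2⟫_ℝ) : f = g := by
  rw [← sub_eq_zero, Lp.eq_zero_iff_ae_eq_zero]
  refine ae_eq_zero_of_integral_contDiff_smul_eq_zero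
    ((Lp.memLp (f - g)).locallyIntegrable (by norm_num)) fun ψ h1 h2 => ?_
  have hψ : IsTest ψ := ⟨h1, h2⟩
  have := hψ.inner_toL2 (f - g)
  rw [inner_sub_left, h ψ hψ, sub_self] at this
  simpa [mul_comm] using this.symm

theorem hasWeakPartial_iff {i : Fin n} {f g : L2 n} : HasWeakPartial i f g ↔
    ∀ (ψ : Rn n → ℝ) (hψ : IsTest ψ), ⟪f, (hψ.partialDeriv i).toL2⟫_ℝ = -⟪g, hψ.toL2⟫_ℝ := by
  refine ⟨fun h ψ hψ => ?_, fun h ψ h1 h2 => ?_⟩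
  · rw [IsTest.inner_toL2, IsTest.inner_toL2]
    exact h ψ hψ.1 hψ.2
  · have hψ : IsTest ψ := ⟨h1, h2⟩
    have := h ψ hψ
    rw [IsTest.inner_toL2, IsTest.inner_toL2] at this
    exact this

theorem HasWeakPartial.unique {i : Fin n} {f g g' : L2 n} (h : HasWeakPartial i f g)
    (h' : HasWeakPartial i f g') : g = g' :=
  ext_of_inner_test fun ψ hψ => by
    have h1 := hasWeakPartial_iff.1 h ψ hψ
    have h2 := hasWeakPartial_iff.1 h' ψ hψ
    linarith

theorem isClosed_hasWeakPartial (i : Fin n) :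
    IsClosed {p : L2 n × L2 n | HasWeakPartial i p.1 p.2} := by
  simp only [hasWeakPartial_iff, Set.ofPred_forall]
  exact isClosed_iInter fun ψ => isClosed_iInter fun hψ =>
    isClosed_eq (continuous_fst.inner continuous_const) (continuous_snd.inner continuous_const).neg

theorem IsTest.hasWeakPartial {ψ : Rn n → ℝ} (hψ : IsTest ψ) (i : Fin n) :
    HasWeakPartial i hψ.toL2 (hψ.partialDeriv i).toL2 := by
  intro φ h1 h2
  have hφ : IsTest φ := ⟨h1, h2⟩
  have e1 : ∫ x, hψ.toL2 x * fderiv ℝ φ x (EuclideanSpace.single i 1)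
      = ∫ x, ψ x * fderiv ℝ φ x (EuclideanSpace.single i 1) := by
    refine integral_congr_ae ?_
    filter_upwards [hψ.coeFn_toL2] with x hx
    rw [hx]
  have e2 : ∫ x, (hψ.partialDeriv i).toL2 x * φ x
      = ∫ x, fderiv ℝ ψ x (EuclideanSpace.single i 1) * φ x := by
    refine integral_congr_ae ?_
    filter_upwards [(hψ.partialDeriv i).coeFn_toL2] with x hx
    rw [hx]
    rfl
  rw [e1, e2]
  refine integral_mul_fderiv_eq_neg_fderiv_mul_of_integrable ?_ ?_ ?_
    (fun x _ => hψ.1.differentiable (by simp) x) (fun x _ => hφ.1.differentiable (by simp) x)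
  · exact (hψ.partialDeriv i).memLp.integrable_mul hφ.memLp
  · exact hψ.memLp.integrable_mul (hφ.partialDeriv i).memLp
  · exact hψ.memLp.integrable_mul hφ.memLp

/-- Translation `f ↦ f (· + v)` on `L²`. -/
noncomputable def translate (v : Rn n) : L2 n →ₗᵢ[ℝ] L2 n :=
  Lp.compMeasurePreservingₗᵢ ℝ (fun x => x + v) (measurePreserving_add_right volume v)

theorem coeFn_translate (v : Rn n) (f : L2 n) :
    translate v f =ᵐ[volume] fun x => f (x + v) :=
  Lp.coeFn_compMeasurePreserving f (measurePreserving_add_right volume v)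

theorem inner_translate_test (v : Rn n) (f : L2 n) {ψ : Rn n → ℝ} (hψ : IsTest ψ) :
    ⟪translate v f, hψ.toL2⟫_ℝ = ⟪f, (hψ.comp_sub_const v).toL2⟫_ℝ := by
  rw [IsTest.inner_toL2, IsTest.inner_toL2,
    ← integral_add_right_eq_self (fun x => f x * ψ (x - v)) v]
  refine integral_congr_ae ?_
  filter_upwards [coeFn_translate v f] with x hx
  rw [hx, add_sub_cancel_right]

theorem translate_zero (f : L2 n) : translate 0 f = f :=
  ext_of_inner_test fun ψ hψ => by
    rw [inner_translate_test, IsTest.inner_toL2, IsTest.inner_toL2]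
    simp

theorem inner_translate_left (v : Rn n) (f g : L2 n) :
    ⟪f, translate v g⟫_ℝ = ⟪translate (-v) f, g⟫_ℝ := by
  have : f = translate v (translate (-v) f) :=
    ext_of_inner_test fun ψ hψ => by
      rw [inner_translate_test, inner_translate_test, IsTest.inner_toL2, IsTest.inner_toL2]
      simp
  nth_rw 1 [this]
  exact (translate v).inner_map_map _ _

theorem continuous_translate (f : L2 n) : Continuous fun v : Rn n => translate v f := by
  let g : Rn n → C(Rn n, Rn n) := fun v => ⟨fun x => x + v, by fun_prop⟩
  have hg : Continuous g := ContinuousMap.continuous_of_continuous_uncurry _ (by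
    change Continuous fun p : Rn n × Rn n => p.2 + p.1
    fun_prop)
  exact (continuous_const (y := f)).compMeasurePreservingLp hg
    (fun v => measurePreserving_add_right volume v) (by simp)

theorem HasWeakPartial.translate {i : Fin n} {f g : L2 n} (h : HasWeakPartial i f g) (v : Rn n) :
    HasWeakPartial i (translate v f) (translate v g) := by
  rw [hasWeakPartial_iff]
  intro ψ hψ
  rw [inner_translate_test, inner_translate_test,
    ← hasWeakPartial_iff.1 h _ (hψ.comp_sub_const v)]
  congr 2
  exact (funext fun x => partialDeriv_comp_sub_const i ψ v x).symm

theorem hasDerivAt_inner_translate_test (i : Fin n) (f : L2 n) {ψ : Rn n → ℝ} (hψ : IsTest ψ)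
    (s : ℝ) : HasDerivAt
      (fun s : ℝ => ⟪Plate.translate (s • EuclideanSpace.single i 1) f, hψ.toL2⟫_ℝ)
      (-⟪Plate.translate (s • EuclideanSpace.single i 1) f, (hψ.partialDeriv i).toL2⟫_ℝ) s := by
  set e : Rn n := EuclideanSpace.single i 1
  let g : Rn n → ℝ := fun x => ψ (-x)
  have hg1 : ContDiff ℝ 1 g := (hψ.1.of_le (by norm_cast)).comp contDiff_neg
  have hg2 : HasCompactSupport g := hψ.2.comp_homeomorph (Homeomorph.neg _)
  have hloc : LocallyIntegrable f (volume : Measure (Rn n)) :=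
    (Lp.memLp f).locallyIntegrable (by norm_num)
  have h := hg2.hasFDerivAt_convolution_right (ContinuousLinearMap.mul ℝ ℝ) hloc hg1 (s • e)
  have hc := h.comp_hasDerivAt s ((hasDerivAt_id s).smul_const e)
  rw [one_smul, convolution_precompR_apply _ hloc (hg2.fderiv ℝ)
    (hg1.continuous_fderiv one_ne_zero)] at hc
  have e1 : ∀ s : ℝ, ⟪Plate.translate (s • e) f, hψ.toL2⟫_ℝ
      = convolution f g (ContinuousLinearMap.mul ℝ ℝ) volume (s • e) := fun s => by
    rw [inner_translate_test, IsTest.inner_toL2]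
    simp [convolution, g]
  refine (hc.congr_of_eventuallyEq (Eventually.of_forall e1)).congr_deriv ?_
  rw [inner_translate_test, IsTest.inner_toL2, ← integral_neg]
  refine integral_congr_ae (Eventually.of_forall fun x => ?_)
  have : fderiv ℝ g (s • e - x) e = -fderiv ℝ ψ (x - s • e) e := by
    have h1 : HasFDerivAt ψ (fderiv ℝ ψ (x - s • e)) (-(s • e - x)) := by
      rw [neg_sub]
      exact (hψ.1.differentiable (by simp) _).hasFDerivAt
    have h2 : HasFDerivAt g _ (s • e - x) := h1.comp (s • e - x) (hasFDerivAt_id _).neg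
    rw [h2.fderiv]
    simp
  simp [this, partialDeriv, e]

theorem HasWeakPartial.translate_sub_eq_integral {i : Fin n} {f g : L2 n}
    (h : HasWeakPartial i f g) (t : ℝ) :
    Plate.translate (t • EuclideanSpace.single i 1) f
      = f + ∫ s in (0 : ℝ)..t, Plate.translate (s • EuclideanSpace.single i 1) g := by
  have hc : Continuous fun s : ℝ => Plate.translate (s • EuclideanSpace.single i 1) g :=
    (continuous_translate g).comp (by fun_prop)
  refine ext_of_inner_test fun ψ hψ => ?_
  have hd : ∀ s : ℝ, HasDerivAt
      (fun s : ℝ => ⟪Plate.translate (s • EuclideanSpace.single i 1) f, hψ.toL2⟫_ℝ)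
      ⟪Plate.translate (s • EuclideanSpace.single i 1) g, hψ.toL2⟫_ℝ s := fun s => by
    have := hasDerivAt_inner_translate_test i f hψ s
    rwa [hasWeakPartial_iff.1 (h.translate _) ψ hψ, neg_neg] at this
  have hint := intervalIntegral.integral_eq_sub_of_hasDerivAt (a := 0) (b := t)
    (fun s _ => hd s) ((hc.inner continuous_const).intervalIntegrable _ _)
  rw [zero_smul, translate_zero] at hint
  have hcomm : ⟪∫ s in (0 : ℝ)..t, Plate.translate (s • EuclideanSpace.single i 1) g, hψ.toL2⟫_ℝ
      = ∫ s in (0 : ℝ)..t, ⟪Plate.translate (s • EuclideanSpace.single i 1) g, hψ.toL2⟫_ℝ := by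
    rw [real_inner_comm]
    simp only [real_inner_comm hψ.toL2]
    exact ((innerSL ℝ hψ.toL2).intervalIntegral_comp_comm (hc.intervalIntegrable 0 t)).symm
  rw [inner_add_left, hcomm, hint]
  ring

theorem HasWeakPartial.hasDerivAt_translate {i : Fin n} {f g : L2 n} (h : HasWeakPartial i f g) :
    HasDerivAt (fun s : ℝ => Plate.translate (s • EuclideanSpace.single i 1) f) g 0 := by
  have hc : Continuous fun s : ℝ => Plate.translate (s • EuclideanSpace.single i 1) g :=
    (continuous_translate g).comp (by fun_prop)
  have := ((intervalIntegral.integral_hasDerivAt_right (hc.intervalIntegrable 0 0)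
    (hc.stronglyMeasurableAtFilter _ _) hc.continuousAt).const_add f)
  rw [zero_smul, translate_zero] at this
  exact this.congr_of_eventuallyEq (Eventually.of_forall h.translate_sub_eq_integral)

/-- Integration by parts for weak partial derivatives in `L²`. -/
theorem HasWeakPartial.inner_eq_neg {i : Fin n} {f g f' g' : L2 n} (h : HasWeakPartial i f g)
    (h' : HasWeakPartial i f' g') : ⟪g, f'⟫_ℝ = -⟪f, g'⟫_ℝ := by
  have h1 := h.hasDerivAt_translate.inner ℝ h'.hasDerivAt_translate
  simp only [LinearIsometry.inner_map_map, zero_smul, translate_zero] at h1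
  have := h1.unique (hasDerivAt_const _ _)
  linarith

theorem inner_second_partials {i j : Fin n} {fi fj fii fij fji fjj : L2 n} (hii : HasWeakPartial i fi fii)
    (hij : HasWeakPartial j fi fij) (hji : HasWeakPartial i fj fji)
    (hjj : HasWeakPartial j fj fjj) : ⟪fii, fjj⟫_ℝ = ⟪fij, fji⟫_ℝ := by
  let e : Rn n := EuclideanSpace.single j 1
  have key : ∀ s : ℝ, ⟪fii, Plate.translate (s • e) fj⟫_ℝ
      = -⟪fi, Plate.translate (s • e) fji⟫_ℝ := fun s => hii.inner_eq_neg (hji.translate _)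
  have h1 : HasDerivAt (fun s : ℝ => ⟪fii, Plate.translate (s • e) fj⟫_ℝ) ⟪fii, fjj⟫_ℝ 0 := by
    simpa using (hasDerivAt_const (0 : ℝ) fii).inner ℝ hjj.hasDerivAt_translate
  have hneg : HasDerivAt (fun s : ℝ => Plate.translate (-(s • e)) fi) (-fij) 0 := by
    have h0 : HasDerivAt (fun s : ℝ => Plate.translate (s • e) fi) fij (-0) := by
      rw [neg_zero]
      exact hij.hasDerivAt_translate
    have := h0.scomp (0 : ℝ) (hasDerivAt_neg (0 : ℝ))
    simpa [Function.comp_def] using this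
  have h2 : HasDerivAt (fun s : ℝ => ⟪fii, Plate.translate (s • e) fj⟫_ℝ) ⟪fij, fji⟫_ℝ 0 := by
    simp only [key, inner_translate_left]
    have := (hneg.inner ℝ (hasDerivAt_const (0 : ℝ) fji)).neg
    simp only [inner_zero_right, zero_add, inner_neg_left, neg_neg] at this
    exact this
  exact h1.unique h2

theorem second_partials_comm {i j : Fin n} {f fi fj fij fji : L2 n}
    (hi : HasWeakPartial i f fi) (hj : HasWeakPartial j f fj)
    (hij : HasWeakPartial j fi fij) (hji : HasWeakPartial i fj fji) : fij = fji :=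
  ext_of_inner_test fun ψ hψ => by
    have h1 := hasWeakPartial_iff.1 hij ψ hψ
    have h2 := hasWeakPartial_iff.1 hji ψ hψ
    have h3 := hasWeakPartial_iff.1 hi _ (hψ.partialDeriv j)
    have h4 := hasWeakPartial_iff.1 hj _ (hψ.partialDeriv i)
    have h5 : ((hψ.partialDeriv j).partialDeriv i).toL2
        = ((hψ.partialDeriv i).partialDeriv j).toL2 := by
      congr 1
      exact partialDeriv_comm hψ i j
    rw [h5] at h3
    linarith

end Sobolev

section SobolevTwo

variable {n : ℕ}

theorem isClosed_H2 : IsClosed (H2 n : Set (L2 n × (Fin n → L2 n) × (Fin n → Fin n → L2 n))) := by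
  have : (H2 n : Set (L2 n × (Fin n → L2 n) × (Fin n → Fin n → L2 n)))
      = (⋂ i, (fun p => (p.1, p.2.1 i)) ⁻¹' {q | HasWeakPartial i q.1 q.2}) ∩
        ⋂ i, ⋂ j, (fun p => (p.2.1 i, p.2.2 i j)) ⁻¹' {q | HasWeakPartial j q.1 q.2} := by
    ext p
    simp [H2]
  rw [this]
  refine (isClosed_iInter fun i => ?_).inter (isClosed_iInter fun i => isClosed_iInter fun j => ?_)
  · exact (isClosed_hasWeakPartial i).preimage (by fun_prop)
  · exact (isClosed_hasWeakPartial j).preimage (by fun_prop)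

instance : CompleteSpace (H2 n) := isClosed_H2.completeSpace_coe

theorem toL2_injective : Function.Injective (toL2 : H2 n → L2 n) := by
  rintro ⟨⟨f, g, h⟩, hf⟩ ⟨⟨f', g', h'⟩, hf'⟩ (rfl : f = f')
  have hg : g = g' := funext fun i => (hf.1 i).unique (hf'.1 i)
  subst hg
  have hh : h = h' := funext fun i => funext fun j => (hf.2 i j).unique (hf'.2 i j)
  subst hh
  rfl

/-- `toL2` as a continuous linear map. -/
noncomputable def toL2L (n : ℕ) : H2 n →L[ℝ] L2 n :=
  ContinuousLinearMap.fst ℝ _ _ ∘L (H2 n).subtypeL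

/-- The weak Laplacian as a continuous linear map. -/
noncomputable def laplacianL (n : ℕ) : H2 n →L[ℝ] L2 n :=
  ∑ i, (ContinuousLinearMap.proj i ∘L ContinuousLinearMap.proj i ∘L
    ContinuousLinearMap.snd ℝ (Fin n → L2 n) (Fin n → Fin n → L2 n) ∘L
    ContinuousLinearMap.snd ℝ (L2 n) _ ∘L (H2 n).subtypeL)

theorem toL2L_apply (f : H2 n) : toL2L n f = toL2 f := rfl

theorem laplacianL_apply (f : H2 n) : laplacianL n f = laplacian f := by
  simp [laplacianL, laplacian]

/-- Test functions as elements of `H²`. -/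
noncomputable def IsTest.toH2 {ψ : Rn n → ℝ} (hψ : IsTest ψ) : H2 n :=
  ⟨(hψ.toL2, fun i => (hψ.partialDeriv i).toL2,
    fun i j => ((hψ.partialDeriv i).partialDeriv j).toL2),
    fun i => hψ.hasWeakPartial i, fun i j => (hψ.partialDeriv i).hasWeakPartial j⟩

theorem denseRange_toL2 : DenseRange (toL2 : H2 n → L2 n) := by
  have h : ((toL2L n).range)ᗮ = ⊥ := by
    rw [Submodule.eq_bot_iff]
    intro z hz
    refine ext_of_inner_test fun ψ hψ => ?_
    rw [inner_zero_left, real_inner_comm]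
    exact (Submodule.mem_orthogonal _ z).1 hz _ ⟨hψ.toH2, rfl⟩
  exact Submodule.dense_iff_topologicalClosure_eq_top.2
    (Submodule.topologicalClosure_eq_top_iff.2 h)

theorem sum_norm_second_partials_sq (f : H2 n) :
    ∑ i, ∑ j, ‖f.1.2.2 i j‖ ^ 2 = ‖laplacian f‖ ^ 2 := by
  rw [← real_inner_self_eq_norm_sq, laplacian, sum_inner]
  refine Finset.sum_congr rfl fun i _ => ?_
  rw [inner_sum]
  refine Finset.sum_congr rfl fun j _ => ?_
  have h := f.2
  rw [inner_second_partials (h.2 i i) (h.2 i j) (h.2 j i) (h.2 j j),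
    second_partials_comm (h.1 i) (h.1 j) (h.2 i j) (h.2 j i), real_inner_self_eq_norm_sq]

theorem norm_second_partial_le (f : H2 n) (i j : Fin n) : ‖f.1.2.2 i j‖ ≤ ‖laplacian f‖ := by
  refine le_of_sq_le_sq ?_ (norm_nonneg _)
  rw [← sum_norm_second_partials_sq]
  refine (Finset.single_le_sum (f := fun j => ‖f.1.2.2 i j‖ ^ 2) (fun _ _ => sq_nonneg _)
    (Finset.mem_univ j)).trans ?_
  exact Finset.single_le_sum (f := fun i => ∑ j, ‖f.1.2.2 i j‖ ^ 2)
    (fun _ _ => Finset.sum_nonneg fun _ _ => sq_nonneg _) (Finset.mem_univ i)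

theorem norm_first_partial_le (f : H2 n) (i : Fin n) :
    ‖f.1.2.1 i‖ ≤ ‖toL2 f‖ + ‖laplacian f‖ := by
  refine le_of_sq_le_sq ?_ (by positivity)
  have h := (f.2.1 i).inner_eq_neg (f.2.2 i i)
  rw [real_inner_self_eq_norm_sq] at h
  have h1 := neg_le_of_abs_le (abs_real_inner_le_norm f.1.1 (f.1.2.2 i i))
  have h2 := mul_le_mul_of_nonneg_left (norm_second_partial_le f i i) (norm_nonneg f.1.1)
  have e : ‖toL2 f‖ = ‖f.1.1‖ := rfl
  rw [e]
  nlinarith [norm_nonneg f.1.1, norm_nonneg (laplacian f), sq_nonneg ‖f.1.1‖,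
    sq_nonneg ‖laplacian f‖]

/-- Elliptic regularity: the graph norm of the Laplacian controls the norm of `H²`. -/
theorem norm_le_graph_norm (f : H2 n) : ‖f‖ ≤ ‖toL2 f‖ + ‖laplacian f‖ := by
  have hL := norm_nonneg (laplacian f)
  have h0 := norm_nonneg (toL2 f)
  refine norm_prod_le_iff.2 ⟨?_, norm_prod_le_iff.2 ⟨?_, ?_⟩⟩
  · exact le_add_of_nonneg_right hL
  · exact (pi_norm_le_iff_of_nonneg (by positivity)).2 fun i => norm_first_partial_le f i
  · refine (pi_norm_le_iff_of_nonneg (by positivity)).2 fun i =>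
      (pi_norm_le_iff_of_nonneg (by positivity)).2 fun j => ?_
    exact (norm_second_partial_le f i j).trans (le_add_of_nonneg_left h0)

/-- The graph embedding `f ↦ (f, Δ f)` of `H²` into a Hilbert space. -/
noncomputable def graphL (n : ℕ) : H2 n →L[ℝ] WithLp 2 (L2 n × L2 n) :=
  ((WithLp.prodContinuousLinearEquiv 2 ℝ (L2 n) (L2 n)).symm :
    L2 n × L2 n →L[ℝ] WithLp 2 (L2 n × L2 n)) ∘L ((toL2L n).prod (laplacianL n))

theorem inner_graphL (f g : H2 n) :
    ⟪graphL n f, graphL n g⟫_ℝ = ⟪toL2 f, toL2 g⟫_ℝ + ⟪laplacian f, laplacian g⟫_ℝ := by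
  rw [WithLp.prod_inner_apply, ← laplacianL_apply, ← laplacianL_apply]
  rfl

theorem antilipschitz_graphL : AntilipschitzWith 2 (graphL n) := by
  refine (graphL n).antilipschitz_of_bound fun f => ?_
  have h : ‖graphL n f‖ ^ 2 = ‖toL2 f‖ ^ 2 + ‖laplacian f‖ ^ 2 := by
    rw [← real_inner_self_eq_norm_sq, inner_graphL, real_inner_self_eq_norm_sq,
      real_inner_self_eq_norm_sq]
  have h1 : ‖toL2 f‖ ≤ ‖graphL n f‖ := by
    refine le_of_sq_le_sq ?_ (norm_nonneg _)
    nlinarith [sq_nonneg ‖laplacian f‖]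
  have h2 : ‖laplacian f‖ ≤ ‖graphL n f‖ := by
    refine le_of_sq_le_sq ?_ (norm_nonneg _)
    nlinarith [sq_nonneg ‖toL2 f‖]
  have := norm_le_graph_norm f
  push_cast
  linarith

theorem isClosed_range_graphL : IsClosed (range (graphL n)) :=
  antilipschitz_graphL.isClosed_range (graphL n).uniformContinuous

/-- `H²` is isomorphic to the graph of the Laplacian. -/
noncomputable def graphEquiv (n : ℕ) : H2 n ≃L[ℝ] (graphL n).range :=
  (graphL n).equivRange antilipschitz_graphL.injective isClosed_range_graphL

instance : CompleteSpace (graphL n).range := isClosed_range_graphL.completeSpace_coe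

theorem inner_graphEquiv (f g : H2 n) : ⟪graphEquiv n f, graphEquiv n g⟫_ℝ
    = ⟪toL2 f, toL2 g⟫_ℝ + ⟪laplacian f, laplacian g⟫_ℝ := inner_graphL f g

end SobolevTwo

section Potential

variable {n : ℕ}

theorem memLp_top (V : Rn n →ᵇ ℝ) : MemLp V ⊤ (volume : Measure (Rn n)) :=
  memLp_top_of_bound V.continuous.aestronglyMeasurable ‖V‖
    (Eventually.of_forall V.norm_coe_le_norm)

/-- Multiplication by a bounded continuous function on `L²`. -/
noncomputable def mulL (V : Rn n →ᵇ ℝ) : L2 n →L[ℝ] L2 n :=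
  (ContinuousLinearMap.mul ℝ ℝ).holderL volume ⊤ 2 2 ((memLp_top V).toLp V)

theorem coeFn_mulL (V : Rn n →ᵇ ℝ) (f : L2 n) : mulL V f =ᵐ[volume] fun x => V x * f x := by
  have h := (ContinuousLinearMap.mul ℝ ℝ).coeFn_holder (r := 2) ((memLp_top V).toLp V) f
  filter_upwards [h, (memLp_top V).coeFn_toLp] with x h1 h2
  rw [← h2]
  exact h1

theorem inner_mulL (V : Rn n →ᵇ ℝ) (f g : L2 n) : ⟪mulL V f, g⟫_ℝ = ∫ x, V x * f x * g x := by
  rw [L2.inner_def]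
  refine integral_congr_ae ?_
  filter_upwards [coeFn_mulL V f] with x hx
  rw [hx]
  simp [mul_comm]

theorem inner_mulL_comm (V : Rn n →ᵇ ℝ) (f g : L2 n) : ⟪mulL V f, g⟫_ℝ = ⟪mulL V g, f⟫_ℝ := by
  rw [inner_mulL, inner_mulL]
  exact integral_congr_ae (Eventually.of_forall fun x => by ring)

theorem two_mul_inner_le (V : Rn n →ᵇ ℝ) (hV : ∀ x, 0 < V x) (f g : L2 n)
    (hf : Integrable (fun x => |f x| ^ 2 / V x)) :
    2 * ⟪f, g⟫_ℝ ≤ (∫ x, |f x| ^ 2 / V x) + ⟪mulL V g, g⟫_ℝ := by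
  have hint : Integrable fun x => V x * g x * g x := by
    have h := L2.integrable_inner (𝕜 := ℝ) (mulL V g) g
    refine h.congr ?_
    filter_upwards [coeFn_mulL V g] with x hx
    rw [hx]
    simp [mul_comm]
  rw [inner_mulL, L2.inner_def, ← integral_const_mul, ← integral_add hf hint]
  refine integral_mono ((L2.integrable_inner (𝕜 := ℝ) f g).const_mul 2) (hf.add hint) fun x => ?_
  have hx := hV x
  simp only [RCLike.inner_apply, conj_trivial, sq_abs]
  have : f x ^ 2 / V x + V x * g x * g x - 2 * (g x * f x) = (f x - V x * g x) ^ 2 / V x := by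
    field_simp
    ring
  have h2 : 0 ≤ (f x - V x * g x) ^ 2 / V x := by positivity
  linarith

end Potential

section Plate

variable {n : ℕ}

theorem exists_isPlateSolution (V : Rn n →ᵇ ℝ) (u₀ : H2 n) (u₁ : L2 n) :
    ∃ u, IsPlateSolution V u₀ u₁ u := by
  let e := graphEquiv n
  let ι : (graphL n).range →L[ℝ] L2 n :=
    toL2L n ∘L (e.symm : (graphL n).range →L[ℝ] H2 n)
  have hι : ∀ w, ι w = toL2 (e.symm w) := fun w => rfl
  have hinj : Function.Injective ι := toL2_injective.comp e.symm.injective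
  have hdense : DenseRange ι :=
    denseRange_toL2.comp e.symm.surjective.denseRange (toL2L n).continuous
  obtain ⟨u, v, hu, hv, hu0, hv0, hd, hw⟩ := exists_wave_solution ι hinj hdense
    (ContinuousLinearMap.id ℝ _ - mulL V) (e u₀) u₁
  refine ⟨fun t => e.symm (u t), e.symm.continuous.comp_continuousOn hu, by simp [hu0],
    v, hv, hv0, hd, fun φ t ht => ?_⟩
  have h := hw (e φ) t ht
  simp only [hι, e.symm_apply_apply] at h
  refine h.congr_deriv ?_
  have h1 : ⟪u t, e φ⟫_ℝ = ⟪toL2 (e.symm (u t)), toL2 φ⟫_ℝ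
      + ⟪laplacian (e.symm (u t)), laplacian φ⟫_ℝ := by
    rw [← inner_graphEquiv]
    congr 1
    exact (e.apply_symm_apply _).symm
  rw [h1, ← inner_mulL, _root_.sub_apply, inner_sub_left]
  simp only [ContinuousLinearMap.id_apply]
  ring

theorem IsPlateSolution.sub {V : Rn n →ᵇ ℝ} {u₀ w₀ : H2 n} {u₁ w₁ : L2 n} {u w : ℝ → H2 n}
    (hu : IsPlateSolution V u₀ u₁ u) (hw : IsPlateSolution V w₀ w₁ w) :
    IsPlateSolution V (u₀ - w₀) (u₁ - w₁) fun t => u t - w t := by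
  obtain ⟨ut, hu1, hu2, hu3, hu4⟩ := hu.velocity
  obtain ⟨wt, hw1, hw2, hw3, hw4⟩ := hw.velocity
  refine ⟨hu.continuousOn.sub hw.continuousOn, by rw [hu.initial, hw.initial],
    fun t => ut t - wt t, hu1.sub hw1, by simp only [hu2, hw2], fun t ht => ?_, fun φ t ht => ?_⟩
  · exact (hu3 t ht).sub (hw3 t ht)
  · have h := (hu4 φ t ht).sub (hw4 φ t ht)
    simp only [← inner_mulL, ← laplacianL_apply, ← toL2L_apply] at h ⊢
    simp only [inner_sub_left, map_sub]
    refine h.congr_deriv ?_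
    ring

/-- The estimate of the `L²` norm of a solution, obtained from the conservation of the energy of
its primitive in time. -/
theorem IsPlateSolution.norm_sq_le {V : Rn n →ᵇ ℝ} (hV : ∀ x, 0 < V x) {u₀ : H2 n} {u₁ : L2 n}
    {u : ℝ → H2 n} (hu : IsPlateSolution V u₀ u₁ u)
    (hint : Integrable (fun x => |u₁ x| ^ 2 / V x)) {t : ℝ} (ht : 0 ≤ t) :
    ‖toL2 (u t)‖ ^ 2 ≤ ‖toL2 u₀‖ ^ 2 + ∫ x, |u₁ x| ^ 2 / V x := by
  obtain ⟨ut, -, hut0, hut, hweak⟩ := hu.velocity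
  let v : ℝ → H2 n := fun t => ∫ r in (0 : ℝ)..t, u (max r 0)
  have hv0 : v 0 = 0 := intervalIntegral.integral_same
  have hv : ∀ t, 0 ≤ t → HasDerivWithinAt v (u t) (Ici 0) t := fun t ht => by
    have := (hasDerivAt_integral_comp_max_zero hu.continuousOn t).hasDerivWithinAt (s := Ici 0)
    rwa [max_eq_left ht] at this
  have hvP : ∀ t, 0 ≤ t → HasDerivWithinAt (fun t => toL2L n (v t)) (toL2L n (u t)) (Ici 0) t :=
    fun t ht => (toL2L n).hasFDerivAt.comp_hasDerivWithinAt t (hv t ht)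
  have hvL : ∀ t, 0 ≤ t →
      HasDerivWithinAt (fun t => laplacianL n (v t)) (laplacianL n (u t)) (Ici 0) t :=
    fun t ht => (laplacianL n).hasFDerivAt.comp_hasDerivWithinAt t (hv t ht)
  have hvM : ∀ t, 0 ≤ t → HasDerivWithinAt (fun t => mulL V (toL2L n (v t)))
      (mulL V (toL2L n (u t))) (Ici 0) t :=
    fun t ht => (mulL V).hasFDerivAt.comp_hasDerivWithinAt t (hvP t ht)
  simp only [← inner_mulL, ← laplacianL_apply, ← toL2L_apply] at hut hweak ⊢
  have hprim : ∀ (φ : H2 n) t, 0 ≤ t → ⟪ut t, toL2L n φ⟫_ℝ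
      + (⟪laplacianL n (v t), laplacianL n φ⟫_ℝ + ⟪mulL V (toL2L n (v t)), toL2L n φ⟫_ℝ)
      = ⟪u₁, toL2L n φ⟫_ℝ := fun φ t ht => by
    have := eq_of_hasDerivWithinAt_Ici_zero (F := fun t => ⟪ut t, toL2L n φ⟫_ℝ
      + (⟪laplacianL n (v t), laplacianL n φ⟫_ℝ + ⟪mulL V (toL2L n (v t)), toL2L n φ⟫_ℝ))
      (fun t ht => by
        have h := (hweak φ t ht).add (((hvL t ht).inner ℝ (hasDerivWithinAt_const t _
          (laplacianL n φ))).add ((hvM t ht).inner ℝ (hasDerivWithinAt_const t _ (toL2L n φ))))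
        refine h.congr_deriv ?_
        simp) ht
    simpa [hv0, hut0] using this
  have henergy := eq_of_hasDerivWithinAt_Ici_zero (F := fun t => ‖toL2L n (u t)‖ ^ 2
      + ‖laplacianL n (v t)‖ ^ 2 + ⟪mulL V (toL2L n (v t)), toL2L n (v t)⟫_ℝ
      - 2 * ⟪u₁, toL2L n (v t)⟫_ℝ) (fun t ht => by
    have h := (((hut t ht).norm_sq.add (hvL t ht).norm_sq).add
      ((hvM t ht).inner ℝ (hvP t ht))).sub
        (((hasDerivWithinAt_const t _ u₁).inner ℝ (hvP t ht)).const_mul 2)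
    refine h.congr_deriv ?_
    have h1 := hprim (u t) t ht
    have h2 := inner_mulL_comm V (toL2L n (u t)) (toL2L n (v t))
    have h3 := real_inner_comm (ut t) (toL2L n (u t))
    rw [inner_zero_left, add_zero]
    linarith) ht
  simp only [hv0, map_zero, norm_zero, inner_zero_right, hu.initial] at henergy
  have hK := two_mul_inner_le V hV u₁ (toL2L n (v t)) hint
  nlinarith [sq_nonneg ‖laplacianL n (v t)‖]

theorem IsPlateSolution.eqOn {V : Rn n →ᵇ ℝ} (hV : ∀ x, 0 < V x) {u₀ : H2 n} {u₁ : L2 n}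
    {u w : ℝ → H2 n} (hu : IsPlateSolution V u₀ u₁ u) (hw : IsPlateSolution V u₀ u₁ w) :
    EqOn w u (Ici 0) := fun t ht => by
  have h := hw.sub hu
  rw [sub_self, sub_self] at h
  have h0 : (fun x => |(0 : L2 n) x| ^ 2 / V x) =ᵐ[volume] 0 :=
    Eventually.of_forall fun x => by simp
  have hle := h.norm_sq_le hV ((integrable_zero _ _ _).congr h0.symm) ht
  rw [integral_congr_ae h0] at hle
  have hz : toL2 (w t - u t) = 0 := by
    rw [← norm_eq_zero]
    refine pow_eq_zero_iff two_ne_zero |>.1 (le_antisymm ?_ (sq_nonneg _))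
    simpa [← toL2L_apply] using hle
  exact sub_eq_zero.1 (toL2_injective hz)

end Plate

end Plate

theorem theorem1p7 :
    ∃ C : ℝ, 0 < C ∧
      ∀ (n : ℕ), 1 ≤ n →
      ∀ (V : BoundedContinuousFunction (Plate.Rn n) ℝ), (∀ x, 0 < V x) →
      ∀ (u₀ : Plate.H2 n) (u₁ : Plate.L2 n),
        Integrable (fun x => |u₁ x| ^ 2 / V x) volume →
        ∃ u : ℝ → Plate.H2 n,
          Plate.IsPlateSolution V u₀ u₁ u ∧
          (∀ w : ℝ → Plate.H2 n, Plate.IsPlateSolution V u₀ u₁ w → EqOn w u (Ici 0)) ∧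
          ∀ t : ℝ, 0 ≤ t →
            ‖Plate.toL2 (u t)‖ ^ 2 ≤ C * (‖Plate.toL2 u₀‖ ^ 2 + ∫ x, |u₁ x| ^ 2 / V x) := by
  refine ⟨1, one_pos, fun n _ V hV u₀ u₁ hint => ?_⟩
  obtain ⟨u, hu⟩ := Plate.exists_isPlateSolution V u₀ u₁
  refine ⟨u, hu, fun w hw => hu.eqOn hV hw, fun t ht => ?_⟩
  rw [one_mul]
  exact hu.norm_sq_le hV hint ht
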